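/- Let $n>m$ be nonnegative integers, and let $P_1,\dots,P_m\subset\mathbb R^n$ be Newton polytopes (convex hulls of finite subsets of $\mathbb N^n$) with $0\in P_j$ for all $j$. Let $\mathcal P(P_j)$ be the finite-dimensional complex vector space of polynomials in $\mathbb C[x_1,\dots,x_n]$ whose support lies in $P_j\cap\mathbb N^n$. For $h=\sum_\alpha a_\alpha z^\alpha\in\mathbb C[z_1,\dots,z_N]$ with Newton polytope $\Gamma(h)$ (the convex hull of the support of $h$) and $w\in\mathbb Z^N$, let $h_w=\sum_{\alpha\in\Delta}a_\alpha z^\alpha$, where $\Delta=\{\alpha\in\Gamma(h):\langle w,\alpha\rangle=\min_{\beta\in\Gamma(h)}\langle w,\beta\rangle\}$. Then there is a nonempty Zariski-open subset $U$ of $\mathcal P(P_1)\times\cdots\times\mathcal P(P_m)\times\mathbb C^n$ such that for every $(f_1,\dots,f_m,u)\in U$ and every nonzero $w\in\mathbb Z^{n+m}$ the facial system $$(f_1)_w=\cdots=(f_m)_w=0,\qquad \Bigl(x_i-u_i+\sum_{j=1}^m\lambda_j\,\frac{\partial f_j}{\partial x_i}(x)\Bigr)_w=0\quad(i=1,\dots,n),$$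 where all the polynomials are regarded as polynomials in the $n+m$ variables $(x,\lambda)=(x_1,\dots,x_n,\lambda_1,\dots,\lambda_m)$, has no solution $(x,\lambda)\in(\mathbb C^\times)^n\times(\mathbb C^\times)^m$. -/

import Mathlib

noncomputable section

namespace EDFace

/-- The regular (polynomial) functions on a complex vector space: the algebra of functions
generated by the linear forms. -/
def polyFun (V : Type*) [AddCommGroup V] [Module ℂ V] : Subalgebra ℂ (V → ℂ) :=
  Algebra.adjoin ℂ (Set.range fun φ : Module.Dual ℂ V => (φ : V → ℂ))

/-- A Zariski-closed set: the common zero locus of a family of polynomial functions. -/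
def IsZariskiClosed {V : Type*} [AddCommGroup V] [Module ℂ V] (Z : Set V) : Prop :=
  ∃ S : Set (V → ℂ), S ⊆ (polyFun V : Set (V → ℂ)) ∧ Z = {v | ∀ p ∈ S, p v = 0}

/-- A Zariski-open set: the complement of a Zariski-closed one. -/
def IsZariskiOpen {V : Type*} [AddCommGroup V] [Module ℂ V] (U : Set V) : Prop :=
  IsZariskiClosed Uᶜ

/-- A property is generic in `V` if it holds on a nonempty Zariski-open subset of `V`. -/
def IsGeneric {V : Type*} [AddCommGroup V] [Module ℂ V] (p : V → Prop) : Prop :=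
  ∃ U : Set V, IsZariskiOpen U ∧ U.Nonempty ∧ ∀ v ∈ U, p v

/-- An exponent vector, as a point of real space. -/
def expVec {σ : Type*} (α : σ →₀ ℕ) : σ → ℝ := fun i => (α i : ℝ)

/-- The Newton polytope of a polynomial: the convex hull of its support. -/
def newtonPolytope {σ : Type*} (h : MvPolynomial σ ℂ) : Set (σ → ℝ) :=
  convexHull ℝ (expVec '' (h.support : Set (σ →₀ ℕ)))

/-- A Newton polytope: the convex hull of a finite set of exponent vectors. -/
def IsNewtonPolytope {σ : Type*} (P : Set (σ → ℝ)) : Prop :=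
  ∃ A : Finset (σ →₀ ℕ), P = convexHull ℝ (expVec '' (A : Set (σ →₀ ℕ)))

/-- The space of the polynomials whose support is contained in `P`. -/
def polySpace {σ : Type*} (P : Set (σ → ℝ)) : Submodule ℂ (MvPolynomial σ ℂ) where
  carrier := {h | ∀ α ∈ h.support, expVec α ∈ P}
  zero_mem' := by simp
  add_mem' := by
    classical
    intro a b ha hb α hα
    rcases Finset.mem_union.1 (MvPolynomial.support_add hα) with h | h
    · exact ha α h
    · exact hb α h
  smul_mem' := by
    intro c a ha α hα
    exact ha α (MvPolynomial.support_smul hα)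

/-- The face of `P` on which the linear form `⟨w, ·⟩` attains its minimum over `P`. -/
def face {σ : Type*} [Fintype σ] (w : σ → ℝ) (P : Set (σ → ℝ)) : Set (σ → ℝ) :=
  {a ∈ P | ∀ b ∈ P, ∑ i, w i * a i ≤ ∑ i, w i * b i}

open Classical in
/-- The face function `h_w`: the part of `h` supported on the face of its Newton polytope
selected by `w`. -/
def facePoly {σ : Type*} [Fintype σ] (w : σ → ℝ) (h : MvPolynomial σ ℂ) : MvPolynomial σ ℂ :=
  ∑ α ∈ h.support with expVec α ∈ face w (newtonPolytope h), MvPolynomial.monomial α (h.coeff α)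

/-- The polynomial `f_j`, seen in the variables `(x, lam)`; `Sum.inl i` is the index of `x_i` and
`Sum.inr j` is the index of `lam_j`. -/
def constraintPoly {n m : ℕ} (f : Fin m → MvPolynomial (Fin n) ℂ) (j : Fin m) :
    MvPolynomial (Fin n ⊕ Fin m) ℂ :=
  MvPolynomial.rename Sum.inl (f j)

/-- The `i`-th coordinate `x_i - u_i + ∑ j, lam_j ∂_i f_j` of the critical point equation, as a
polynomial in `(x, lam)`. -/
def criticalPoly {n m : ℕ} (f : Fin m → MvPolynomial (Fin n) ℂ) (u : Fin n → ℂ) (i : Fin n) :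
    MvPolynomial (Fin n ⊕ Fin m) ℂ :=
  MvPolynomial.X (Sum.inl i) - MvPolynomial.C (u i) +
    ∑ j, MvPolynomial.X (Sum.inr j) *
      MvPolynomial.rename Sum.inl (MvPolynomial.pderiv i (f j))

/-- `(x, lam)` solves the facial system of direction `w`. -/
def SolvesFacialSystem {n m : ℕ} (f : Fin m → MvPolynomial (Fin n) ℂ) (u : Fin n → ℂ)
    (w : Fin n ⊕ Fin m → ℤ) (x : Fin n → ℂ) (lam : Fin m → ℂ) : Prop :=
  (∀ j, MvPolynomial.eval (Sum.elim x lam)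
    (facePoly (fun k => (w k : ℝ)) (constraintPoly f j)) = 0) ∧
  (∀ i, MvPolynomial.eval (Sum.elim x lam)
    (facePoly (fun k => (w k : ℝ)) (criticalPoly f u i)) = 0)

end EDFace

end

noncomputable section

namespace EDFace

open MvPolynomial
open Module (finrank)

/-! The system is the gradient of the Lagrangian `L = ∑ (x_i²/2 - u_i x_i) + ∑ lam_j f_j`, so the
facial equations are those of the partial derivatives of `L`. Since `0 ∈ P_j`, every variable,
`lam_j` included, is itself a monomial allowed in `L`.

Take any exponents `β` containing all the unit vectors, with free coefficients `c`. A solution `y`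
in the torus means that the vector `c_a y^(β a)` lies in a linear space `W` depending only on the
faces. The bad `c` are thus torus translates of `W`, and they lie in a hypersurface as soon as the
codimension of `W` exceeds the number of torus parameters needed. If `w ≥ 0`, the linear monomials
make the equations independent, and quasi-homogeneity saves one torus parameter
(`exists_ne_zero_eval_eq_zero_of_unit_mem`). If `w` has a negative entry, the least weight on all
exponents is negative, the equations become the critical equations of one quasi-homogeneous
polynomial of nonzero degree, and Euler's relation supplies one more independent equation
(`exists_ne_zero_eval_eq_zero_of_quasihomogeneous`).

Finitely many face patterns occur, so one hypersurface serves all `w`. The coefficients of `x_i²` in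
`L` are fixed at `1/2`; rescaling the variables removes this constraint. -/

/-! ### Dimension counts for torus translates of a linear space -/

/-- A polynomial map into an affine space of larger dimension has its image in a hypersurface. -/
theorem exists_ne_zero_eval_comp_eq_zero {ι τ : Type} [Fintype ι] [Fintype τ]
    (h : Fintype.card τ < Fintype.card ι) (g : ι → MvPolynomial τ ℂ) :
    ∃ p : MvPolynomial ι ℂ, p ≠ 0 ∧ ∀ t, eval (fun a => eval t (g a)) p = 0 := by
  have hg : ¬ AlgebraicIndependent ℂ g := by
    intro hg
    have := hg.cardinalMk_le_trdeg
    rw [MvPolynomial.trdeg_of_isDomain] at this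
    simp only [Cardinal.mk_fintype, Cardinal.lift_natCast, Nat.cast_le] at this
    omega
  rw [algebraicIndependent_iff] at hg
  push Not at hg
  obtain ⟨p, hp, hp0⟩ := hg
  refine ⟨p, hp0, fun t => ?_⟩
  have := congrArg (eval t) hp
  rw [map_zero] at this
  rw [← this, aeval_def, ← coe_eval₂Hom, ← RingHom.comp_apply]
  congr 1
  apply MvPolynomial.ringHom_ext
  · intro r; simp [MvPolynomial.algebraMap_eq]
  · intro a; simp

/-- The translates are the image of a polynomial map in `finrank ℂ W + K.card` parameters:
coordinates on `W` and the torus variables not normalized to 1. -/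
theorem exists_ne_zero_eval_torus_translate_eq_zero {ι κ : Type} [Fintype ι] [Fintype κ]
    (β : ι → κ →₀ ℕ) (W : Submodule ℂ (ι → ℂ)) (K : Finset κ)
    (h : finrank ℂ W + K.card < Fintype.card ι) :
    ∃ p : MvPolynomial ι ℂ, p ≠ 0 ∧ ∀ c ∈ W, ∀ z : κ → ℂ, (∀ k ∉ K, z k = 1) →
      eval (fun a => c a * ∏ k, z k ^ β a k) p = 0 := by
  classical
  let b := Module.finBasis ℂ W
  obtain ⟨p, hp0, hp⟩ := exists_ne_zero_eval_comp_eq_zero (ι := ι)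
    (τ := Fin (finrank ℂ W) ⊕ K) (by simpa using h)
    (fun a => (∑ i, C ((b i : ι → ℂ) a) * X (Sum.inl i)) * ∏ k : K, X (Sum.inr k) ^ β a k)
  refine ⟨p, hp0, fun c hc z hz => ?_⟩
  rw [← hp (Sum.elim (fun i => b.repr ⟨c, hc⟩ i) (fun k : K => z k))]
  congr 2
  funext a
  simp only [map_mul, map_sum, map_prod, map_pow, eval_C, eval_X, Sum.elim_inl, Sum.elim_inr]
  congr 1
  · have := congrArg (fun v : W => (v : ι → ℂ) a) (b.sum_repr ⟨c, hc⟩)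
    simp only [Submodule.coe_sum, Submodule.coe_smul, Finset.sum_apply, Pi.smul_apply,
      smul_eq_mul] at this
    rw [← this]
    exact Finset.sum_congr rfl fun i _ => mul_comm _ _
  · rw [Finset.prod_coe_sort K (fun k => z k ^ β a k)]
    symm
    apply Finset.prod_subset (Finset.subset_univ K)
    intro k _ hk
    rw [hz k hk, one_pow]

theorem finrank_add_card_le_of_orthogonal {ι θ : Type} [Fintype ι] [Fintype θ]
    (v : θ → ι → ℂ) (hv : LinearIndependent ℂ v) (W : Submodule ℂ (ι → ℂ))
    (hW : ∀ c ∈ W, ∀ t, ∑ a, v t a * c a = 0) :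
    finrank ℂ W + Fintype.card θ ≤ Fintype.card ι := by
  have h1 := LinearIndependent.rank_matrix (M := Matrix.of v) hv
  have h2 := (Matrix.of v).mulVecLin.finrank_range_add_finrank_ker
  have h3 : W ≤ LinearMap.ker (Matrix.of v).mulVecLin := by
    intro c hc
    rw [LinearMap.mem_ker]
    funext t
    exact hW c hc t
  have h4 := Submodule.finrank_mono h3
  rw [Matrix.rank] at h1
  rw [Module.finrank_pi] at h2
  omega

/-- The common kernel of a family of linear forms given by their coefficients. -/
def orthogonalSpace {ι κ : Type} [Fintype ι] (R : κ → ι → ℂ) : Submodule ℂ (ι → ℂ) where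
  carrier := {c | ∀ k, ∑ a, R k a * c a = 0}
  zero_mem' := by simp
  add_mem' := by
    intro x y hx hy k
    simp only [Pi.add_apply, mul_add, Finset.sum_add_distrib, hx k, hy k, add_zero]
  smul_mem' := by
    intro s x hx k
    have : ∑ a, R k a * (s • x) a = s * ∑ a, R k a * x a := by
      rw [Finset.mul_sum]
      exact Finset.sum_congr rfl fun a _ => by simp only [Pi.smul_apply, smul_eq_mul]; ring
    rw [this, hx k, mul_zero]

theorem mem_orthogonalSpace {ι κ : Type} [Fintype ι] {R : κ → ι → ℂ} {c : ι → ℂ} :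
    c ∈ orthogonalSpace R ↔ ∀ k, ∑ a, R k a * c a = 0 := Iff.rfl

/-! ### One-parameter subgroups and normalization of torus variables -/

theorem prod_mul_exp_pow {κ : Type} [Fintype κ] (z τ : κ → ℂ) (t : ℂ) (α : κ →₀ ℕ) :
    ∏ k, (z k * Complex.exp (t * τ k)) ^ α k =
      Complex.exp (t * ∑ k, τ k * α k) * ∏ k, z k ^ α k := by
  simp only [mul_pow, Finset.prod_mul_distrib, ← Complex.exp_nat_mul]
  rw [← Complex.exp_sum, mul_comm, Finset.mul_sum]
  congr 2
  exact Finset.sum_congr rfl fun k _ => by ring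

theorem exists_exp_mul_eq_one {z τ : ℂ} (hz : z ≠ 0) (hτ : τ ≠ 0) :
    ∃ t, z * Complex.exp (t * τ) = 1 := by
  refine ⟨-Complex.log z / τ, ?_⟩
  rw [div_mul_cancel₀ _ hτ, Complex.exp_neg, Complex.exp_log hz, mul_inv_cancel₀ hz]

/-- A minimal set of variables that parametrizes, up to a common factor, the values of the
monomials `β a`, `a ∈ M`, on the torus. -/
theorem exists_linearIndependent_normalization {ι κ : Type} [Fintype κ]
    (β : ι → κ →₀ ℕ) (M : Finset ι) :
    ∃ K : Finset κ,
      (∀ z : κ → ℂ, (∀ k, z k ≠ 0) → ∃ (z' : κ → ℂ) (s : ℂ), (∀ k, z' k ≠ 0) ∧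
        (∀ k ∉ K, z' k = 1) ∧ ∀ a ∈ M, ∏ k, z k ^ β a k = s * ∏ k, z' k ^ β a k) ∧
      ∀ (τ : κ → ℂ) (τ₀ : ℂ), (∀ k ∉ K, τ k = 0) → (∀ a ∈ M, ∑ k, τ k * β a k = τ₀) → τ = 0 := by
  classical
  let S : Set (Finset κ) := {K | ∀ z : κ → ℂ, (∀ k, z k ≠ 0) → ∃ (z' : κ → ℂ) (s : ℂ),
    (∀ k, z' k ≠ 0) ∧
    (∀ k ∉ K, z' k = 1) ∧ ∀ a ∈ M, ∏ k, z k ^ β a k = s * ∏ k, z' k ^ β a k}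
  have hS : S.Nonempty := ⟨Finset.univ, fun z hz => ⟨z, 1, hz, by simp, by simp⟩⟩
  obtain ⟨K, hK⟩ := (Set.toFinite S).exists_minimal hS
  refine ⟨K, hK.prop, fun τ τ₀ hτK hτ => ?_⟩
  by_contra hne
  obtain ⟨k₀, hk₀⟩ := Function.ne_iff.1 hne
  have hk₀K : k₀ ∈ K := by
    by_contra h
    exact hk₀ (hτK k₀ h)
  -- The subgroup `exp (t τ)` multiplies all monomials of `M` by the same factor, so it can bring
  -- the variable `k₀` to 1, against the minimality of `K`.
  have hmem : K.erase k₀ ∈ S := by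
    intro z hz
    obtain ⟨z', s, hz', hz'K, hs⟩ := hK.prop z hz
    obtain ⟨t, ht⟩ := exists_exp_mul_eq_one (hz' k₀) hk₀
    refine ⟨fun k => z' k * Complex.exp (t * τ k), s * Complex.exp (-(t * τ₀)),
      fun k => mul_ne_zero (hz' k) (Complex.exp_ne_zero _), fun k hk => ?_, fun a ha => ?_⟩
    · by_cases h : k = k₀
      · rw [h]; exact ht
      · have hkK : k ∉ K := fun h' => hk (Finset.mem_erase.2 ⟨h, h'⟩)
        simp [hτK k hkK, hz'K k hkK]
    · rw [prod_mul_exp_pow, hτ a ha, hs a ha, mul_assoc, ← mul_assoc (Complex.exp _),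
        ← Complex.exp_add, neg_add_cancel, Complex.exp_zero, one_mul]
  exact absurd (hK.le_of_le hmem (Finset.erase_subset _ _) hk₀K) (Finset.notMem_erase _ _)

/-! ### Hypersurfaces containing the bad coefficients -/

/-- A generic quasi-homogeneous polynomial of nonzero degree has no critical point in the torus. -/
theorem exists_ne_zero_eval_eq_zero_of_quasihomogeneous {ι κ : Type} [Fintype ι] [Fintype κ]
    (β : ι → κ →₀ ℕ) (M : Finset ι) (hM : M.Nonempty) (w : κ → ℂ) (e : ℂ) (he : e ≠ 0)
    (hw : ∀ a ∈ M, ∑ k, w k * β a k = e) :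
    ∃ p : MvPolynomial ι ℂ, p ≠ 0 ∧ ∀ (c : ι → ℂ) (y : κ → ℂ), (∀ k, y k ≠ 0) →
      (∀ k, ∑ a ∈ M, β a k * (c a * ∏ l, y l ^ β a l) = 0) → eval c p = 0 := by
  classical
  obtain ⟨K, hK, hKτ⟩ := exists_linearIndependent_normalization β M
  let R : κ → ι → ℂ := fun k a => if a ∈ M then (β a k : ℂ) else 0
  let W := orthogonalSpace R
  have hWM : ∀ c, c ∈ W ↔ ∀ k, ∑ a ∈ M, β a k * c a = 0 := by
    intro c
    rw [mem_orthogonalSpace]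
    simp only [R, ite_mul, zero_mul, Finset.sum_ite_mem, Finset.univ_inter]
  -- The row `none` is the sum of the coordinates in `M`, which vanishes on `W` by Euler's relation;
  -- the codimension of `W` is therefore at least `K.card + 1`.
  let v : Option K → ι → ℂ := fun o =>
    o.elim (fun a => if a ∈ M then 1 else 0) (fun k => R k)
  have hv : LinearIndependent ℂ v := by
    rw [Fintype.linearIndependent_iff]
    intro g hg
    have hga : ∀ a ∈ M, g none + ∑ k : K, g (some k) * β a k = 0 := by
      intro a ha
      have := congrFun hg a
      simpa [Fintype.sum_option, v, R, ha] using this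
    have hτ := hKτ (fun k => if h : k ∈ K then g (some ⟨k, h⟩) else 0) (-g none)
      (fun k hk => by simp [hk]) (fun a ha => by
        have h1 := hga a ha
        rw [eq_neg_iff_add_eq_zero, add_comm]
        refine Eq.trans ?_ h1
        congr 1
        rw [← Finset.sum_subset (Finset.subset_univ K) (by intro k _ hk; simp [hk]),
          ← Finset.sum_coe_sort K]
        exact Finset.sum_congr rfl fun k _ => by simp)
    have hsome : ∀ k : K, g (some k) = 0 := by
      intro k
      have := congrFun hτ k
      simpa using this
    obtain ⟨a, ha⟩ := hM
    have hnone : g none = 0 := by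
      have := hga a ha
      simpa [hsome] using this
    rintro (_ | k)
    · exact hnone
    · exact hsome k
  have horth : ∀ c ∈ W, ∀ t, ∑ a, v t a * c a = 0 := by
    rintro c hc (_ | k)
    · have h1 := (hWM c).1 hc
      have h2 : ∑ k, w k * ∑ a ∈ M, β a k * c a = e * ∑ a ∈ M, c a := by
        simp only [Finset.mul_sum]
        rw [Finset.sum_comm]
        refine Finset.sum_congr rfl fun a ha => ?_
        rw [← hw a ha, Finset.sum_mul]
        exact Finset.sum_congr rfl fun k _ => by ring
      simp only [h1, mul_zero, Finset.sum_const_zero] at h2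
      have h3 := (mul_eq_zero.1 h2.symm).resolve_left he
      simpa [v] using h3
    · exact hc k
  have hcard := finrank_add_card_le_of_orthogonal v hv W horth
  obtain ⟨p, hp0, hp⟩ := exists_ne_zero_eval_torus_translate_eq_zero β W K (by
    rw [Fintype.card_option, Fintype.card_coe] at hcard
    omega)
  refine ⟨p, hp0, fun c y hy hc => ?_⟩
  -- Normalizing the inverse of `y` writes `c` as the translate by `z` of a point of `W`.
  obtain ⟨z, s, hz, hzK, hs⟩ := hK (fun k => (y k)⁻¹) (fun k => inv_ne_zero (hy k))
  have hz0 : ∀ a, ∏ k, z k ^ β a k ≠ 0 := fun a =>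
    Finset.prod_ne_zero_iff.2 fun k _ => pow_ne_zero _ (hz k)
  have hy0 : ∀ a, ∏ k, y k ^ β a k ≠ 0 := fun a =>
    Finset.prod_ne_zero_iff.2 fun k _ => pow_ne_zero _ (hy k)
  have hmem : (fun a => c a * (∏ k, z k ^ β a k)⁻¹) ∈ W := by
    rw [hWM]
    intro k
    have h1 : ∀ a ∈ M, (β a k : ℂ) * (c a * (∏ k, z k ^ β a k)⁻¹) =
        s * (β a k * (c a * ∏ l, y l ^ β a l)) := by
      intro a ha
      have h2 := hs a ha
      simp only [inv_pow, Finset.prod_inv_distrib] at h2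
      have h3 : (∏ k, z k ^ β a k)⁻¹ = s * ∏ l, y l ^ β a l := by
        rw [inv_eq_iff_eq_inv, mul_inv, h2]
        have hs0 : s ≠ 0 := by
          rintro rfl
          rw [zero_mul] at h2
          exact inv_ne_zero (hy0 a) h2
        rw [← mul_assoc, inv_mul_cancel₀ hs0, one_mul]
      rw [h3]; ring
    rw [Finset.sum_congr rfl h1, ← Finset.mul_sum, hc k, mul_zero]
  have := hp _ hmem z hzK
  simpa only [mul_assoc, inv_mul_cancel₀ (hz0 _), mul_one] using this

/-- The coordinates at the linear monomials form an identity matrix, so the equations are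
independent. Each is quasi-homogeneous for `w`, so `exp (t w)` preserves their solution space and
can normalize a variable `k₀` with `w k₀ ≠ 0`. -/
theorem exists_ne_zero_eval_eq_zero_of_unit_mem {ι κ : Type} [Fintype ι] [Fintype κ]
    (β : ι → κ →₀ ℕ) (unit : κ → ι) (hunit : ∀ k, β (unit k) = Finsupp.single k 1)
    (σ : κ → Finset ι) (hσ : ∀ k, unit k ∈ σ k) (w : κ → ℂ) (hw0 : w ≠ 0) (e : κ → ℂ)
    (hw : ∀ k, ∀ a ∈ σ k, ∑ l, w l * β a l = e k) :
    ∃ p : MvPolynomial ι ℂ, p ≠ 0 ∧ ∀ (c : ι → ℂ) (y : κ → ℂ), (∀ k, y k ≠ 0) →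
      (∀ k, ∑ a ∈ σ k, β a k * (c a * ∏ l, y l ^ β a l) = 0) → eval c p = 0 := by
  classical
  obtain ⟨k₀, hk₀⟩ := Function.ne_iff.1 hw0
  let R : κ → ι → ℂ := fun k a => if a ∈ σ k then (β a k : ℂ) else 0
  have hR : LinearIndependent ℂ R := by
    rw [Fintype.linearIndependent_iff]
    intro g hg l
    have h := congrFun hg (unit l)
    rw [Finset.sum_apply, Finset.sum_eq_single l] at h
    · simpa [R, hσ l, hunit l] using h
    · intro k _ hk
      simp [R, hunit l, hk.symm]
    · simp
  have hWσ : ∀ c, c ∈ orthogonalSpace R ↔ ∀ k, ∑ a ∈ σ k, β a k * c a = 0 := by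
    intro c
    rw [mem_orthogonalSpace]
    simp only [R, ite_mul, zero_mul, Finset.sum_ite_mem, Finset.univ_inter]
  have hcard := finrank_add_card_le_of_orthogonal R hR (orthogonalSpace R) (fun c hc => hc)
  obtain ⟨p, hp0, hp⟩ := exists_ne_zero_eval_torus_translate_eq_zero β (orthogonalSpace R)
    (Finset.univ.erase k₀) (by
      have h1 : 0 < Fintype.card κ := Fintype.card_pos_iff.2 ⟨k₀⟩
      rw [Finset.card_erase_of_mem (Finset.mem_univ _), Finset.card_univ]
      omega)
  refine ⟨p, hp0, fun c y hy hc => ?_⟩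
  obtain ⟨t, ht⟩ := exists_exp_mul_eq_one (inv_ne_zero (hy k₀)) hk₀
  let z : κ → ℂ := fun k => (y k)⁻¹ * Complex.exp (t * w k)
  have hz0 : ∀ a, ∏ k, z k ^ β a k ≠ 0 := fun a =>
    Finset.prod_ne_zero_iff.2 fun k _ =>
      pow_ne_zero _ (mul_ne_zero (inv_ne_zero (hy k)) (Complex.exp_ne_zero _))
  have hmem : (fun a => c a * (∏ k, z k ^ β a k)⁻¹) ∈ orthogonalSpace R := by
    rw [hWσ]
    intro k
    have h1 : ∀ a ∈ σ k, (β a k : ℂ) * (c a * (∏ l, z l ^ β a l)⁻¹) =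
        (Complex.exp (t * e k))⁻¹ * (β a k * (c a * ∏ l, y l ^ β a l)) := by
      intro a ha
      rw [prod_mul_exp_pow, hw k a ha]
      simp only [inv_pow, Finset.prod_inv_distrib, mul_inv, inv_inv]
      ring
    rw [Finset.sum_congr rfl h1, ← Finset.mul_sum, hc k, mul_zero]
  have := hp _ hmem z (fun k hk => by
    have hk' : k = k₀ := by simpa using hk
    rw [hk']
    exact ht)
  simpa only [mul_assoc, inv_mul_cancel₀ (hz0 _), mul_one] using this

/-- The weight of an exponent vector. -/
def weight {κ : Type} [Fintype κ] (w : κ → ℝ) (α : κ →₀ ℕ) : ℝ := ∑ l, w l * expVec α l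

open Classical in
/-- The indices of the exponents of least weight among those that involve the variable `k`. -/
def minFace {ι κ : Type} [Fintype ι] [Fintype κ] (β : ι → κ →₀ ℕ) (w : κ → ℝ) (k : κ) :
    Finset ι :=
  Finset.univ.filter fun a => β a k ≠ 0 ∧ ∀ b, β b k ≠ 0 → weight w (β a) ≤ weight w (β b)

theorem mem_minFace {ι κ : Type} [Fintype ι] [Fintype κ] {β : ι → κ →₀ ℕ} {w : κ → ℝ} {k : κ}
    {a : ι} : a ∈ minFace β w k ↔
      β a k ≠ 0 ∧ ∀ b, β b k ≠ 0 → weight w (β a) ≤ weight w (β b) := by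
  simp [minFace]

theorem weight_single_one {κ : Type} [Fintype κ] (w : κ → ℝ) (k : κ) :
    weight w (Finsupp.single k 1) = w k := by
  classical
  simp only [weight, expVec, Finsupp.single_apply]
  rw [Finset.sum_eq_single k] <;> simp +contextual [eq_comm]

theorem sum_ofReal_mul_eq_weight {κ : Type} [Fintype κ] (w : κ → ℝ) (α : κ →₀ ℕ) :
    ∑ l, (w l : ℂ) * α l = (weight w α : ℝ) := by
  simp [weight, expVec]

/-- For one direction `w`, the coefficient vectors of the polynomials whose facial gradient system
has a solution in the torus lie on a hypersurface. -/
theorem exists_ne_zero_eval_eq_zero_of_facial {ι κ : Type} [Fintype ι] [Fintype κ]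
    (β : ι → κ →₀ ℕ) (unit : κ → ι) (hunit : ∀ k, β (unit k) = Finsupp.single k 1)
    (w : κ → ℝ) (hw0 : w ≠ 0) :
    ∃ p : MvPolynomial ι ℂ, p ≠ 0 ∧ ∀ (c : ι → ℂ) (y : κ → ℂ), (∀ k, y k ≠ 0) →
      (∀ k, ∑ a ∈ minFace β w k, β a k * (c a * ∏ l, y l ^ β a l) = 0) → eval c p = 0 := by
  classical
  have hunit1 : ∀ k, β (unit k) k ≠ 0 := fun k => by simp [hunit k]
  have hwunit : ∀ k, weight w (β (unit k)) = w k := fun k => by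
    rw [hunit, weight_single_one]
  -- For `w ≥ 0`, an exponent involving `k` has weight at least `w k`, so the monomial `k` itself
  -- lies on the face.
  by_cases hpos : ∀ k, 0 ≤ w k
  · have hmem : ∀ k, unit k ∈ minFace β w k := by
      intro k
      refine mem_minFace.2 ⟨hunit1 k, fun b hb => ?_⟩
      rw [hwunit]
      have h1 : (1 : ℝ) ≤ expVec (β b) k := by
        simp only [expVec]
        exact_mod_cast Nat.one_le_iff_ne_zero.2 hb
      calc w k ≤ w k * expVec (β b) k := le_mul_of_one_le_right (hpos k) h1
        _ ≤ weight w (β b) := Finset.single_le_sum (f := fun l => w l * expVec (β b) l)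
            (fun l _ => mul_nonneg (hpos l) (Nat.cast_nonneg _)) (Finset.mem_univ k)
    refine exists_ne_zero_eval_eq_zero_of_unit_mem β unit hunit (minFace β w) hmem
      (fun k => (w k : ℂ)) ?_ (fun k => (w k : ℂ)) ?_
    · intro h
      exact hw0 (funext fun k => by simpa using congrFun h k)
    · intro k a ha
      rw [sum_ofReal_mul_eq_weight, ← hwunit k]
      congr 1
      exact le_antisymm ((mem_minFace.1 ha).2 _ (hunit1 k))
        ((mem_minFace.1 (hmem k)).2 _ (mem_minFace.1 ha).1)
  · push Not at hpos
    obtain ⟨k₁, hk₁⟩ := hpos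
    obtain ⟨a₀, -, ha₀⟩ := Finset.exists_min_image Finset.univ (fun a => weight w (β a))
      ⟨unit k₁, Finset.mem_univ _⟩
    let M : Finset ι := Finset.univ.filter fun a => weight w (β a) = weight w (β a₀)
    have he : weight w (β a₀) < 0 := by
      have := ha₀ (unit k₁) (Finset.mem_univ _)
      rw [hwunit] at this
      linarith
    obtain ⟨p, hp0, hp⟩ := exists_ne_zero_eval_eq_zero_of_quasihomogeneous β M
      ⟨a₀, by simp [M]⟩ (fun k => (w k : ℂ)) (weight w (β a₀) : ℝ)
      (by exact_mod_cast he.ne) (fun a ha => by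
        rw [sum_ofReal_mul_eq_weight, (Finset.mem_filter.1 ha).2])
    refine ⟨p, hp0, fun c y hy hc => hp c y hy fun k => ?_⟩
    -- If `k` occurs in `M`, the face for `k` consists of the members of `M` involving `k`;
    -- otherwise the critical equation for `k` is trivial.
    by_cases hk : ∃ a ∈ M, β a k ≠ 0
    · obtain ⟨a₁, ha₁, ha₁k⟩ := hk
      rw [← hc k]
      symm
      apply Finset.sum_subset_zero_on_sdiff
      · intro a ha
        refine Finset.mem_filter.2 ⟨Finset.mem_univ _, le_antisymm ?_ (ha₀ a (Finset.mem_univ _))⟩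
        rw [← (Finset.mem_filter.1 ha₁).2]
        exact (mem_minFace.1 ha).2 _ ha₁k
      · intro a ha
        obtain ⟨ha1, ha2⟩ := Finset.mem_sdiff.1 ha
        have : β a k = 0 := by
          by_contra h
          refine ha2 (mem_minFace.2 ⟨h, fun b _ => ?_⟩)
          rw [(Finset.mem_filter.1 ha1).2]
          exact ha₀ b (Finset.mem_univ _)
        simp [this]
      · intro a _; rfl
    · push Not at hk
      exact Finset.sum_eq_zero fun a ha => by simp [hk a ha]

/-- If the exponents `β` include all the unit vectors, then the facial gradient systems of a
generic polynomial with these exponents have no solution in the torus. -/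
theorem exists_ne_zero_forall_not_facial {ι κ : Type} [Fintype ι] [Fintype κ]
    (β : ι → κ →₀ ℕ) (unit : κ → ι) (hunit : ∀ k, β (unit k) = Finsupp.single k 1) :
    ∃ p : MvPolynomial ι ℂ, p ≠ 0 ∧ ∀ (w : κ → ℝ), w ≠ 0 →
      ∀ (c : ι → ℂ) (y : κ → ℂ), (∀ k, y k ≠ 0) →
      (∀ k, ∑ a ∈ minFace β w k, β a k * (c a * ∏ l, y l ^ β a l) = 0) → eval c p = 0 := by
  classical
  -- The directions are infinite in number but the patterns `σ` are finitely many; a pattern that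
  -- does not occur gets the polynomial 1.
  have h : ∀ σ : κ → Finset ι, ∃ p : MvPolynomial ι ℂ, p ≠ 0 ∧ ∀ w : κ → ℝ, w ≠ 0 →
      minFace β w = σ → ∀ (c : ι → ℂ) (y : κ → ℂ), (∀ k, y k ≠ 0) →
      (∀ k, ∑ a ∈ σ k, β a k * (c a * ∏ l, y l ^ β a l) = 0) → eval c p = 0 := by
    intro σ
    by_cases hσ : ∃ w : κ → ℝ, w ≠ 0 ∧ minFace β w = σ
    · obtain ⟨w, hw0, rfl⟩ := hσ
      obtain ⟨p, hp0, hp⟩ := exists_ne_zero_eval_eq_zero_of_facial β unit hunit w hw0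
      exact ⟨p, hp0, fun _ _ _ => hp⟩
    · exact ⟨1, one_ne_zero, fun w hw0 hw => absurd ⟨w, hw0, hw⟩ hσ⟩
  choose p hp0 hp using h
  refine ⟨∏ σ, p σ, Finset.prod_ne_zero_iff.2 fun σ _ => hp0 σ, fun w hw0 c y hy hc => ?_⟩
  rw [map_prod]
  exact Finset.prod_eq_zero (Finset.mem_univ (minFace β w)) (hp _ w hw0 rfl c y hy hc)

/-! ### Face polynomials of partial derivatives -/

theorem mem_face_newtonPolytope {κ : Type} [Fintype κ] {w : κ → ℝ} {h : MvPolynomial κ ℂ}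
    {α : κ →₀ ℕ} (hα : α ∈ h.support) :
    expVec α ∈ face w (newtonPolytope h) ↔ ∀ γ ∈ h.support, weight w α ≤ weight w γ := by
  constructor
  · intro hf γ hγ
    exact hf.2 _ (subset_convexHull ℝ _ ⟨γ, hγ, rfl⟩)
  · intro hmin
    refine ⟨subset_convexHull ℝ _ ⟨α, hα, rfl⟩, fun b hb => ?_⟩
    have hlin : IsLinearMap ℝ fun b : κ → ℝ => ∑ i, w i * b i :=
      ⟨fun x y => by simp [mul_add, Finset.sum_add_distrib],
        fun r x => by simp only [Pi.smul_apply, smul_eq_mul, Finset.mul_sum]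
                      exact Finset.sum_congr rfl fun i _ => by ring⟩
    refine convexHull_min (t := {b | weight w α ≤ ∑ i, w i * b i}) ?_
      (convex_halfSpace_ge hlin _) hb
    rintro _ ⟨γ, hγ, rfl⟩
    exact hmin γ hγ

theorem weight_add {κ : Type} [Fintype κ] (w : κ → ℝ) (α γ : κ →₀ ℕ) :
    weight w (α + γ) = weight w α + weight w γ := by
  simp [weight, expVec, mul_add, Finset.sum_add_distrib]

/-- Multiplying by `y k` restores the original exponents and shifts all weights by `w k`, which
leaves the minimizers unchanged. Injectivity of `β` and nonzero coefficients rule out cancellation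
in the support. -/
theorem mul_eval_facePoly_pderiv {ι κ : Type} [Fintype ι] [Fintype κ]
    (β : ι → κ →₀ ℕ) (hβ : Function.Injective β) (c : ι → ℂ) (hc : ∀ a, c a ≠ 0)
    (w : κ → ℝ) (k : κ) (y : κ → ℂ) :
    y k * eval y (facePoly w (pderiv k (∑ a, monomial (β a) (c a)))) =
      ∑ a ∈ minFace β w k, β a k * (c a * ∏ l, y l ^ β a l) := by
  classical
  let γ : ι → κ →₀ ℕ := fun a => β a - Finsupp.single k 1
  let S : Finset ι := Finset.univ.filter fun a => β a k ≠ 0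
  have hγ : ∀ a, β a k ≠ 0 → Finsupp.single k 1 + γ a = β a := fun a ha =>
    add_tsub_cancel_of_le (Finsupp.single_le_iff.2 (Nat.one_le_iff_ne_zero.2 ha))
  have hinj : ∀ a, β a k ≠ 0 → ∀ b, β b k ≠ 0 → γ a = γ b → a = b := by
    intro a ha b hb hab
    apply hβ
    rw [← hγ a ha, ← hγ b hb, hab]
  have hL : pderiv k (∑ a, monomial (β a) (c a)) =
      ∑ a ∈ S, monomial (γ a) (c a * β a k) := by
    rw [map_sum]
    simp only [pderiv_monomial]
    symm
    apply Finset.sum_subset (Finset.subset_univ _)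
    intro a _ ha
    have : β a k = 0 := by simpa [S] using ha
    simp [this]
  rw [hL]
  set h := ∑ a ∈ S, monomial (γ a) (c a * β a k) with hh
  have hcoeff : ∀ a ∈ S, h.coeff (γ a) = c a * β a k := by
    intro a ha
    rw [hh, coeff_sum, Finset.sum_eq_single a]
    · simp
    · intro b hb hba
      rw [coeff_monomial, if_neg]
      exact fun hab => hba (hinj b (Finset.mem_filter.1 hb).2 a (Finset.mem_filter.1 ha).2 hab)
    · exact fun h => absurd ha h
  have hsupp : h.support = S.image γ := by
    apply Finset.Subset.antisymm
    · intro α hα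
      by_contra hn
      rw [mem_support_iff, hh, coeff_sum] at hα
      refine hα (Finset.sum_eq_zero fun a ha => ?_)
      rw [coeff_monomial, if_neg]
      exact fun h => hn (Finset.mem_image.2 ⟨a, ha, h⟩)
    · intro α hα
      obtain ⟨a, ha, rfl⟩ := Finset.mem_image.1 hα
      rw [mem_support_iff, hcoeff a ha]
      exact mul_ne_zero (hc a) (by exact_mod_cast (Finset.mem_filter.1 ha).2)
  have hweight : ∀ a, β a k ≠ 0 → weight w (β a) = w k + weight w (γ a) := by
    intro a ha
    rw [← weight_single_one w k, ← weight_add, hγ a ha]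
  have hface : (h.support.filter fun α => expVec α ∈ face w (newtonPolytope h)) =
      (minFace β w k).image γ := by
    ext α
    rw [Finset.mem_filter, Finset.mem_image]
    constructor
    · rintro ⟨hα, hf⟩
      rw [mem_face_newtonPolytope hα] at hf
      rw [hsupp] at hα hf
      obtain ⟨a, ha, rfl⟩ := Finset.mem_image.1 hα
      have hak := (Finset.mem_filter.1 ha).2
      refine ⟨a, mem_minFace.2 ⟨hak, fun b hb => ?_⟩, rfl⟩
      rw [hweight a hak, hweight b hb]
      gcongr
      exact hf _ (Finset.mem_image_of_mem _ (Finset.mem_filter.2 ⟨Finset.mem_univ _, hb⟩))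
    · rintro ⟨a, ha, rfl⟩
      obtain ⟨hak, hmin⟩ := mem_minFace.1 ha
      have hα : γ a ∈ h.support := by
        rw [hsupp]
        exact Finset.mem_image_of_mem _ (Finset.mem_filter.2 ⟨Finset.mem_univ _, hak⟩)
      refine ⟨hα, (mem_face_newtonPolytope hα).2 fun δ hδ => ?_⟩
      rw [hsupp] at hδ
      obtain ⟨b, hb, rfl⟩ := Finset.mem_image.1 hδ
      have hbk := (Finset.mem_filter.1 hb).2
      have := hmin b hbk
      rw [hweight a hak, hweight b hbk] at this
      linarith
  have hfp : facePoly w h = ∑ a ∈ minFace β w k, monomial (γ a) (c a * β a k) := by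
    have : facePoly w h = ∑ α ∈ (minFace β w k).image γ, monomial α (h.coeff α) := by
      rw [← hface]
      unfold facePoly
      congr!
    rw [this, Finset.sum_image fun a ha b hb => hinj a (mem_minFace.1 ha).1 b (mem_minFace.1 hb).1]
    exact Finset.sum_congr rfl fun a ha => by
      rw [hcoeff a (Finset.mem_filter.2 ⟨Finset.mem_univ _, (mem_minFace.1 ha).1⟩)]
  rw [hfp, map_sum, Finset.mul_sum]
  refine Finset.sum_congr rfl fun a ha => ?_
  have h1 : (X k : MvPolynomial κ ℂ) * monomial (γ a) (c a * β a k) =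
      monomial (β a) (c a * β a k) := by
    rw [X, monomial_mul, one_mul, hγ a (mem_minFace.1 ha).1]
  have h2 := congrArg (eval y) h1
  rw [map_mul, eval_X] at h2
  rw [h2, eval_monomial, Finsupp.prod_fintype _ _ (by simp)]
  ring

theorem finite_setOf_expVec_mem {n : ℕ} {P : Set (Fin n → ℝ)} (hP : IsNewtonPolytope P) :
    {α : Fin n →₀ ℕ | expVec α ∈ P}.Finite := by
  obtain ⟨A, rfl⟩ := hP
  refine (Set.finite_Iic (∑ α ∈ A, α)).subset fun γ hγ i => ?_
  have hlin : IsLinearMap ℝ fun b : Fin n → ℝ => b i := ⟨fun _ _ => rfl, fun _ _ => rfl⟩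
  have h : expVec γ i ≤ ((∑ α ∈ A, α : Fin n →₀ ℕ) i : ℝ) := by
    refine convexHull_min (t := {b | b i ≤ ((∑ α ∈ A, α : Fin n →₀ ℕ) i : ℝ)}) ?_
      (convex_halfSpace_le hlin _) hγ
    rintro _ ⟨δ, hδ, rfl⟩
    have : δ ≤ ∑ α ∈ A, α := Finset.single_le_sum (f := fun α => α) (fun _ _ => zero_le) hδ
    simp only [Set.mem_ofPred_eq, expVec]
    exact_mod_cast this i
  simp only [expVec] at h
  exact_mod_cast h

/-! ### The Lagrangian and its gradient -/

/-- The index set of the terms `lam_j x^α`, `x_i` and `x_i ^ 2` of the Lagrangian. -/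
abbrev LagrangeIndex {n m : ℕ} (A : Fin m → Finset (Fin n →₀ ℕ)) : Type :=
  (Σ j, A j) ⊕ (Fin n ⊕ Fin n)

/-- The exponents of the terms of the Lagrangian. -/
def lagrangeExp {n m : ℕ} (A : Fin m → Finset (Fin n →₀ ℕ)) :
    LagrangeIndex A → (Fin n ⊕ Fin m) →₀ ℕ
  | Sum.inl a => Finsupp.single (Sum.inr a.1) 1 + (a.2 : Fin n →₀ ℕ).mapDomain Sum.inl
  | Sum.inr (Sum.inl i) => Finsupp.single (Sum.inl i) 1
  | Sum.inr (Sum.inr i) => Finsupp.single (Sum.inl i) 2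

/-- The coefficients of the Lagrangian
`∑ i, (x_i ^ 2 / 2 - u_i x_i) + ∑ j, lam_j f_j`. -/
def lagrangeCoeff {n m : ℕ} (A : Fin m → Finset (Fin n →₀ ℕ))
    (f : Fin m → MvPolynomial (Fin n) ℂ) (u : Fin n → ℂ) : LagrangeIndex A → ℂ
  | Sum.inl a => (f a.1).coeff a.2
  | Sum.inr (Sum.inl i) => -u i
  | Sum.inr (Sum.inr _) => 1 / 2

theorem mapDomain_inl_inr {n m : ℕ} (α : Fin n →₀ ℕ) (j : Fin m) :
    α.mapDomain (Sum.inl : Fin n → Fin n ⊕ Fin m) (Sum.inr j) = 0 :=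
  Finsupp.mapDomain_of_notMem_range _ _ (by simp)

theorem lagrangeExp_injective {n m : ℕ} (A : Fin m → Finset (Fin n →₀ ℕ)) :
    Function.Injective (lagrangeExp A) := by
  have hsum : ∀ (j : Fin m) (α : Fin n →₀ ℕ) (j' : Fin m),
      (Finsupp.single (Sum.inr j) 1 + α.mapDomain Sum.inl : Fin n ⊕ Fin m →₀ ℕ) (Sum.inr j') =
        if j = j' then 1 else 0 := by
    intro j α j'
    rw [Finsupp.add_apply, mapDomain_inl_inr, add_zero, Finsupp.single_apply]
    simp
  rintro (⟨j, α⟩ | i | i) (⟨j', α'⟩ | i' | i') h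
  · have hj : j = j' := by
      have := DFunLike.congr_fun h (Sum.inr j)
      simp only [lagrangeExp, hsum, if_true] at this
      by_contra hne
      rw [if_neg (Ne.symm hne)] at this
      exact one_ne_zero this
    subst hj
    have := Finsupp.mapDomain_injective Sum.inl_injective (add_left_cancel h)
    have h2 : α = α' := Subtype.ext this
    rw [h2]
  · have := DFunLike.congr_fun h (Sum.inr j)
    simp only [lagrangeExp, hsum, if_true] at this
    simp at this
  · have := DFunLike.congr_fun h (Sum.inr j)
    simp only [lagrangeExp, hsum, if_true] at this
    simp at this
  · have := DFunLike.congr_fun h (Sum.inr j')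
    simp only [lagrangeExp, hsum, if_true] at this
    simp at this
  · have := Finsupp.single_left_injective one_ne_zero h
    rw [Sum.inl_injective this]
  · have := DFunLike.congr_fun h (Sum.inl i)
    simp only [lagrangeExp, Finsupp.single_apply] at this
    split_ifs at this <;> simp_all
  · have := DFunLike.congr_fun h (Sum.inr j')
    simp only [lagrangeExp, hsum, if_true] at this
    simp at this
  · have := DFunLike.congr_fun h (Sum.inl i)
    simp only [lagrangeExp, Finsupp.single_apply] at this
    split_ifs at this <;> simp_all
  · have := Finsupp.single_left_injective two_ne_zero h
    rw [Sum.inl_injective this]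

theorem sum_monomial_lagrange {n m : ℕ} (A : Fin m → Finset (Fin n →₀ ℕ))
    (f : Fin m → MvPolynomial (Fin n) ℂ) (hf : ∀ j, (f j).support ⊆ A j) (u : Fin n → ℂ) :
    ∑ a, monomial (lagrangeExp A a) (lagrangeCoeff A f u a) =
      ∑ j, X (Sum.inr j) * rename Sum.inl (f j) +
        (∑ i, -(C (u i) * X (Sum.inl i)) + ∑ i, C (1 / 2) * X (Sum.inl i) ^ 2) := by
  rw [Fintype.sum_sum_type, Fintype.sum_sum_type, Fintype.sum_sigma]
  congr 1
  · refine Finset.sum_congr rfl fun j _ => ?_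
    have h : f j = ∑ α : A j, monomial (α : Fin n →₀ ℕ) ((f j).coeff α) := by
      conv_lhs => rw [(f j).as_sum]
      rw [Finset.sum_coe_sort (A j) (fun α => monomial α ((f j).coeff α))]
      refine Finset.sum_subset (hf j) fun α _ hα => ?_
      rw [notMem_support_iff.1 hα, map_zero]
    conv_rhs => rw [h]
    rw [map_sum, Finset.mul_sum]
    refine Finset.sum_congr rfl fun α _ => ?_
    rw [rename_monomial, X, monomial_mul, one_mul]
    rfl
  · congr 1
    · refine Finset.sum_congr rfl fun i _ => ?_
      rw [← neg_mul, ← map_neg, C_mul_X_eq_monomial]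
      rfl
    · refine Finset.sum_congr rfl fun i _ => ?_
      rw [C_mul_X_pow_eq_monomial]
      rfl

theorem pderiv_inl_rename_inl {n m : ℕ} (i : Fin n) (f : MvPolynomial (Fin n) ℂ) :
    pderiv (Sum.inl i : Fin n ⊕ Fin m) (rename Sum.inl f) = rename Sum.inl (pderiv i f) :=
  pderiv_rename Sum.inl_injective i f

theorem pderiv_inr_rename_inl {n m : ℕ} (j : Fin m) (f : MvPolynomial (Fin n) ℂ) :
    pderiv (Sum.inr j : Fin n ⊕ Fin m) (rename Sum.inl f) = 0 := by
  classical
  apply pderiv_eq_zero_of_notMem_vars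
  intro h
  obtain ⟨i, -, hi⟩ := Finset.mem_image.1 (vars_rename Sum.inl f h)
  exact Sum.inl_ne_inr hi

theorem constraintPoly_eq_pderiv {n m : ℕ} (A : Fin m → Finset (Fin n →₀ ℕ))
    (f : Fin m → MvPolynomial (Fin n) ℂ) (hf : ∀ j, (f j).support ⊆ A j) (u : Fin n → ℂ)
    (j : Fin m) :
    constraintPoly f j = pderiv (Sum.inr j)
      (∑ a, monomial (lagrangeExp A a) (lagrangeCoeff A f u a)) := by
  classical
  rw [sum_monomial_lagrange A f hf u]
  simp only [map_add, map_sum, Derivation.leibniz, Derivation.leibniz_pow, map_neg,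
    pderiv_inr_rename_inl, pderiv_X, pderiv_C, smul_eq_mul]
  simp [Pi.single_apply, constraintPoly]

theorem criticalPoly_eq_pderiv {n m : ℕ} (A : Fin m → Finset (Fin n →₀ ℕ))
    (f : Fin m → MvPolynomial (Fin n) ℂ) (hf : ∀ j, (f j).support ⊆ A j) (u : Fin n → ℂ)
    (i : Fin n) :
    criticalPoly f u i = pderiv (Sum.inl i)
      (∑ a, monomial (lagrangeExp A a) (lagrangeCoeff A f u a)) := by
  classical
  have h2 : (C (2 : ℂ)⁻¹ : MvPolynomial (Fin n ⊕ Fin m) ℂ) * 2 = 1 := by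
    rw [← map_ofNat C 2, ← C_mul, inv_mul_cancel₀ two_ne_zero, C_1]
  rw [sum_monomial_lagrange A f hf u]
  simp only [map_add, map_sum, Derivation.leibniz, Derivation.leibniz_pow, map_neg,
    pderiv_inl_rename_inl, pderiv_X, pderiv_C, smul_eq_mul]
  simp [Pi.single_apply, criticalPoly, ← mul_assoc, h2]
  ring

/-! ### Genericity in the parameters `(f, u)` -/

theorem polyFun_eval_mem {V ι : Type} [AddCommGroup V] [Module ℂ V] (g : ι → V → ℂ)
    (hg : ∀ a, g a ∈ polyFun V) (p : MvPolynomial ι ℂ) :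
    (fun v => eval (fun a => g a v) p) ∈ polyFun V := by
  have h : (fun v => eval (fun a => g a v) p) = aeval g p := by
    funext v
    have : (Pi.evalAlgHom ℂ (fun _ : V => ℂ) v).comp (aeval g) = aeval (fun a => g a v) := by
      ext a
      simp
    have h2 := DFunLike.congr_fun this p
    rw [AlgHom.comp_apply, Pi.evalAlgHom_apply] at h2
    rw [h2, aeval_eq_eval]
  rw [h]
  clear h
  induction p using MvPolynomial.induction_on with
  | C r => rw [aeval_C]; exact Subalgebra.algebraMap_mem _ r
  | add p q hp hq =>
    rw [map_add]
    exact Subalgebra.add_mem _ hp hq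
  | mul_X p a hp =>
    rw [map_mul, aeval_X]
    exact Subalgebra.mul_mem _ hp (hg a)

theorem lagrangeCoeff_mem_polyFun {n m : ℕ} (P : Fin m → Set (Fin n → ℝ))
    (A : Fin m → Finset (Fin n →₀ ℕ)) (a : LagrangeIndex A) :
    (fun F : ((j : Fin m) → polySpace (P j)) × (Fin n → ℂ) =>
      lagrangeCoeff A (fun j => (F.1 j : MvPolynomial (Fin n) ℂ)) F.2 a) ∈
      polyFun (((j : Fin m) → polySpace (P j)) × (Fin n → ℂ)) := by
  rcases a with a | i | i
  · refine Algebra.subset_adjoin ⟨(lcoeff ℂ (a.2 : Fin n →₀ ℕ)) ∘ₗ (polySpace (P a.1)).subtype ∘ₗ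
      LinearMap.proj a.1 ∘ₗ LinearMap.fst ℂ _ _, ?_⟩
    rfl
  · refine Algebra.subset_adjoin ⟨-(LinearMap.proj i ∘ₗ LinearMap.snd ℂ _ _), ?_⟩
    rfl
  · exact Subalgebra.algebraMap_mem _ (1 / 2 : ℂ)

end EDFace

end

theorem mainTheorem3 (n m : ℕ) (hmn : m < n) (P : Fin m → Set (Fin n → ℝ))
    (hP : ∀ j, EDFace.IsNewtonPolytope (P j)) (h0 : ∀ j, (0 : Fin n → ℝ) ∈ P j) :
    EDFace.IsGeneric fun F : ((j : Fin m) → EDFace.polySpace (P j)) × (Fin n → ℂ) =>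
      ∀ w : Fin n ⊕ Fin m → ℤ, w ≠ 0 →
        ¬ ∃ (x : Fin n → ℂ) (lam : Fin m → ℂ), (∀ i, x i ≠ 0) ∧ (∀ j, lam j ≠ 0) ∧
          EDFace.SolvesFacialSystem
            (fun j => (F.1 j : MvPolynomial (Fin n) ℂ)) F.2 w x lam := by
  classical
  open EDFace MvPolynomial in
  let A : Fin m → Finset (Fin n →₀ ℕ) := fun j => (finite_setOf_expVec_mem (hP j)).toFinset
  have hA : ∀ j α, α ∈ A j ↔ expVec α ∈ P j := fun j α => Set.Finite.mem_toFinset _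
  have hsupp : ∀ (F : (j : Fin m) → polySpace (P j)) (j : Fin m),
      (F j : MvPolynomial (Fin n) ℂ).support ⊆ A j := fun F j α hα => (hA j α).2 ((F j).2 α hα)
  have hzero : ∀ j, (0 : Fin n →₀ ℕ) ∈ A j := fun j => by
    rw [hA]
    convert h0 j
    funext i
    simp [expVec]
  let β := lagrangeExp A
  let unit : Fin n ⊕ Fin m → LagrangeIndex A :=
    Sum.elim (fun i => Sum.inr (Sum.inl i)) (fun j => Sum.inl ⟨j, 0, hzero j⟩)
  have hunit : ∀ k, β (unit k) = Finsupp.single k 1 := by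
    rintro (i | j)
    · rfl
    · simp [β, unit, lagrangeExp]
  obtain ⟨p, hp0, hp⟩ := exists_ne_zero_forall_not_facial β unit hunit
  -- The factor `∏ a, X a` forces all coefficients to be nonzero, so that the supports are full.
  let q : MvPolynomial (LagrangeIndex A) ℂ := p * ∏ a, X a
  have hq0 : q ≠ 0 := mul_ne_zero hp0 (Finset.prod_ne_zero_iff.2 fun a _ => X_ne_zero a)
  obtain ⟨c₀, hc₀⟩ : ∃ c₀, eval c₀ q ≠ 0 := by
    by_contra! h
    exact hq0 (MvPolynomial.funext fun c => by rw [h c, map_zero])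
  have hqne : ∀ c, eval c q ≠ 0 → eval c p ≠ 0 ∧ ∀ a, c a ≠ 0 := by
    intro c hc
    rw [map_mul, map_prod] at hc
    refine ⟨left_ne_zero_of_mul hc, fun a => ?_⟩
    simpa using Finset.prod_ne_zero_iff.1 (right_ne_zero_of_mul hc) a (Finset.mem_univ _)
  -- Scaling `x_i` by `s` turns the fixed coefficient `1/2` of `x_i²` into `s² / 2`, which has to
  -- equal the coefficient in `c₀`.
  have hs : ∀ i : Fin n, ∃ s : ℂ, s ^ 2 = 2 * c₀ (Sum.inr (Sum.inr i)) := fun i =>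
    IsAlgClosed.exists_pow_nat_eq _ two_pos
  choose r hr using hs
  let s : Fin n ⊕ Fin m → ℂ := Sum.elim r fun _ => 1
  have hs0 : ∀ k, s k ≠ 0 := by
    rintro (i | j)
    · intro h
      have h1 := hr i
      rw [show r i = 0 from h] at h1
      have := (hqne c₀ hc₀).2 (Sum.inr (Sum.inr i))
      simp_all
    · exact one_ne_zero
  let T : LagrangeIndex A → ℂ := fun a => ∏ k, s k ^ β a k
  have hT0 : ∀ a, T a ≠ 0 := fun a =>
    Finset.prod_ne_zero_iff.2 fun k _ => pow_ne_zero _ (hs0 k)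
  let cf : ((j : Fin m) → polySpace (P j)) × (Fin n → ℂ) → LagrangeIndex A → ℂ := fun F =>
    lagrangeCoeff A (fun j => (F.1 j : MvPolynomial (Fin n) ℂ)) F.2
  let Q : ((j : Fin m) → polySpace (P j)) × (Fin n → ℂ) → ℂ := fun F =>
    eval (fun a => cf F a * T a) q
  have hQ : Q ∈ polyFun (((j : Fin m) → polySpace (P j)) × (Fin n → ℂ)) := by
    refine polyFun_eval_mem (fun a F => cf F a * T a) (fun a => ?_) q
    exact Subalgebra.mul_mem _ (lagrangeCoeff_mem_polyFun P A a)
      (Subalgebra.algebraMap_mem _ (T a))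
  refine ⟨{F | Q F ≠ 0}, ⟨{Q}, by simpa using hQ, ?_⟩, ?_, ?_⟩
  · ext F
    simp
  · let f₀ : (j : Fin m) → polySpace (P j) := fun j =>
      ⟨∑ α : A j, monomial (α : Fin n →₀ ℕ) (c₀ (Sum.inl ⟨j, α⟩) / T (Sum.inl ⟨j, α⟩)),
        Submodule.sum_mem _ fun α _ γ hγ => by
          rw [Finset.mem_singleton.1 (support_monomial_subset hγ)]
          exact (hA j _).1 α.2⟩
    let u₀ : Fin n → ℂ := fun i => -(c₀ (Sum.inr (Sum.inl i)) / T (Sum.inr (Sum.inl i)))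
    refine ⟨(f₀, u₀), ?_⟩
    have hcf : (fun a => cf (f₀, u₀) a * T a) = c₀ := by
      funext a
      rw [← eq_div_iff (hT0 a)]
      rcases a with ⟨j, α⟩ | i | i
      · simp only [cf, lagrangeCoeff, f₀, coeff_sum, coeff_monomial]
        rw [Finset.sum_eq_single α]
        · simp
        · intro γ _ hγ
          rw [if_neg fun h => hγ (Subtype.ext h)]
        · simp
      · simp [cf, lagrangeCoeff, u₀]
      · have hTi : T (Sum.inr (Sum.inr i)) = 2 * c₀ (Sum.inr (Sum.inr i)) := by
          rw [← hr i]
          simp only [T, β, lagrangeExp]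
          rw [Finset.prod_eq_single (Sum.inl i)]
          · simp [s]
          · intro k _ hk
            rw [Finsupp.single_apply, if_neg hk.symm, pow_zero]
          · simp
        have hne := (hqne c₀ hc₀).2 (Sum.inr (Sum.inr i))
        rw [hTi]
        simp only [cf, lagrangeCoeff]
        field_simp
    change eval (fun a => cf (f₀, u₀) a * T a) q ≠ 0
    rw [hcf]
    exact hc₀
  · rintro F hF w hw ⟨x, lam, hx, hlam, hcon, hcrit⟩
    obtain ⟨hpF, hcF⟩ := hqne _ hF
    have hc : ∀ a, cf F a ≠ 0 := fun a => left_ne_zero_of_mul (hcF a)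
    let y : Fin n ⊕ Fin m → ℂ := Sum.elim x lam
    have hy : ∀ k, y k ≠ 0 := by
      rintro (i | j)
      exacts [hx i, hlam j]
    let w' : Fin n ⊕ Fin m → ℝ := fun k => (w k : ℝ)
    have hw' : w' ≠ 0 := fun h => hw (funext fun k => by
      have := congrFun h k
      simpa [w'] using this)
    have hsys : ∀ k, ∑ a ∈ minFace β w' k, (β a k : ℂ) * (cf F a * ∏ l, y l ^ β a l) = 0 := by
      intro k
      rw [← mul_eval_facePoly_pderiv β (lagrangeExp_injective A) (cf F) hc w' k y]
      rcases k with i | j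
      · have h := hcrit i
        rw [criticalPoly_eq_pderiv A _ (hsupp F.1)] at h
        exact mul_eq_zero_of_right _ h
      · have h := hcon j
        rw [constraintPoly_eq_pderiv A _ (hsupp F.1) F.2] at h
        exact mul_eq_zero_of_right _ h
    -- The rescaled coefficients `cf F a * T a` at the point `y / s` give the same terms as `cf F a`
    -- at `y`.
    refine hpF (hp w' hw' _ (fun k => y k / s k) (fun k => div_ne_zero (hy k) (hs0 k)) fun k => ?_)
    rw [← hsys k]
    refine Finset.sum_congr rfl fun a _ => ?_
    have h1 : ∏ l, (y l / s l) ^ β a l = (∏ l, y l ^ β a l) / T a := by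
      simp only [div_pow, Finset.prod_div_distrib, T]
    have h2 := hT0 a
    rw [h1]
    field_simp
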